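/- \textbf{Setting.} An order (a bid or an ask) has an id, a timestamp, a limit price and a quantity, all natural numbers, the quantity being at least $1$. The input consists of a list $B$ of bids and a list $A$ of asks, all orders having distinct ids and distinct timestamps. A transaction consists of a bid, an ask, a transaction quantity and a transaction price. A bid $b$ and an ask $a$ are tradable if $\mathrm{price}(b)\ge \mathrm{price}(a)$. A finite set $M$ of transactions is a matching over $(B,A)$ if every transaction of $M$ is between a bid from $B$ and an ask from $A$ that are tradable, and for every order $w$ in $B\cup A$ the total quantity of the transactions of $M$ involving $w$ is at most the quantity of $w$. The volume of $M$ is the sum of all its transaction quantities. \textbf{Model.} The prices of the input orders are not given to the algorithm explicitly (all the rest of the input is). In the \emph{comparison model}, the algorithm can have the prices of two orders of its choice compared by an oracle in unit time. In the \emph{binary query model}, it can have an oracle evaluate, in unit time, any function $f:\mathbb N\times\mathbb N\to\{0,1\}$ of its choice on the prices of two orders of its choice. Transactions are output by naming the bid, the ask, the quantity, and a transaction price, which is an explicit number or a copy of the limit price of an order. The worst-case running time on $n$ orders is the supremum of the running time over all inputs with $|B|+|A|=n$. \textbf{Theorem.} Every (deterministic) algorithm that, on each input $(B,A)$, computes a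 matching over $(B,A)$ of maximum volume has worst-case running time $\Omega(n\log n)$ in the comparison model and $\Omega(n\sqrt{\log n})$ in the binary query model, where $n=|B|+|A|$. That is, in each of the two models there are constants $c>0$ and $n_0$ such that for every such algorithm and every $n\ge n_0$ there is an input with $n$ orders on which the algorithm runs for time at least $c\,n\log n$ (respectively, at least $c\,n\sqrt{\log n}$). -/

import Mathlib

namespace Exchange

/-- An order (a bid or an ask): an identification number, a timestamp, a limit price and a
quantity, all natural numbers, the quantity being at least one. -/
structure TradeOrder where
  id : ℕ
  timestamp : ℕ
  price : ℕ
  qty : ℕ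
  qty_pos : 1 ≤ qty
  deriving DecidableEq

/-- A transaction between a bid and an ask, with a transaction quantity and a transaction
price. -/
structure Transaction where
  bid : TradeOrder
  ask : TradeOrder
  qty : ℕ
  price : ℕ
  deriving DecidableEq

/-- A bid and an ask are tradable if the limit price of the bid is at least that of the ask. -/
def Tradable (b a : TradeOrder) : Prop := a.price ≤ b.price

/-- `Qty(w, M)`: the total quantity of the transactions of `M` that involve `w`. -/
def tradedQty (w : TradeOrder) (M : Finset Transaction) : ℕ :=
  ∑ m ∈ M with m.bid = w ∨ m.ask = w, m.qty

/-- `Vol(M)`: the total quantity of all transactions of `M`. -/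
def volume (M : Finset Transaction) : ℕ := ∑ m ∈ M, m.qty

/-- An input: a list of bids and a list of asks; all orders have distinct ids and distinct
timestamps. -/
structure Market where
  bids : List TradeOrder
  asks : List TradeOrder
  nodup_ids : ((bids ++ asks).map TradeOrder.id).Nodup
  nodup_timestamps : ((bids ++ asks).map TradeOrder.timestamp).Nodup

/-- The number of orders in the input. -/
def Market.size (I : Market) : ℕ := I.bids.length + I.asks.length

/-- `M` is a matching over the bids and asks of `I`. Nothing is demanded of the transaction
prices; since a tradable pair always admits a transaction price between its limit prices,
demanding that would only make the task of computing a maximum volume matching harder. -/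
structure IsMatching (I : Market) (M : Finset Transaction) : Prop where
  bid_mem : ∀ m ∈ M, m.bid ∈ I.bids
  ask_mem : ∀ m ∈ M, m.ask ∈ I.asks
  tradable : ∀ m ∈ M, Tradable m.bid m.ask
  qty_le : ∀ w ∈ I.bids ++ I.asks, tradedQty w M ≤ w.qty

/-- `M` is a matching whose volume is the largest among all matchings. -/
def IsMaxVolumeMatching (I : Market) (M : Finset Transaction) : Prop :=
  IsMatching I M ∧ ∀ M' : Finset Transaction, IsMatching I M' → volume M' ≤ volume M

/-! ### What an algorithm sees of its input, and how it refers to it -/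

/-- Everything about an order except its price. -/
structure OrderInfo where
  id : ℕ
  timestamp : ℕ
  qty : ℕ

def TradeOrder.info (w : TradeOrder) : OrderInfo := ⟨w.id, w.timestamp, w.qty⟩

/-- The explicitly given part of the input: the bids and the asks without their prices. -/
structure PublicInput where
  bids : List OrderInfo
  asks : List OrderInfo

def Market.publicInput (I : Market) : PublicInput :=
  ⟨I.bids.map TradeOrder.info, I.asks.map TradeOrder.info⟩

/-- A reference to an order of the input, by its position in the list of bids or of asks. -/
inductive OrderRef where
  | bid (i : ℕ)
  | ask (j : ℕ)

/-- The hidden price of the order referred to (`none` if there is no such order). -/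
def Market.price? (I : Market) : OrderRef → Option ℕ
  | .bid i => I.bids[i]?.map TradeOrder.price
  | .ask j => I.asks[j]?.map TradeOrder.price

/-- How an algorithm writes a transaction price: as an explicit number, or as a copy of the
(hidden) limit price of an order. -/
inductive PriceTerm where
  | const (p : ℕ)
  | priceOf (x : OrderRef)

def PriceTerm.value? (I : Market) : PriceTerm → Option ℕ
  | .const p => some p
  | .priceOf x => I.price? x

/-- A transaction as written by an algorithm: between the `bid`-th bid and the `ask`-th ask. -/
structure TransactionTerm where
  bid : ℕ
  ask : ℕ
  qty : ℕ
  price : PriceTerm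

/-- On the input `I`, the written transaction `τ` stands for the transaction `m`. -/
def TransactionTerm.Denotes (I : Market) (τ : TransactionTerm) (m : Transaction) : Prop :=
  I.bids[τ.bid]? = some m.bid ∧ I.asks[τ.ask]? = some m.ask ∧
    τ.qty = m.qty ∧ τ.price.value? I = some m.price

/-- On the input `I`, the list `out` is a list of transactions that makes up the set `M`. -/
def OutputDenotes (I : Market) (out : List TransactionTerm) (M : Finset Transaction) : Prop :=
  (∀ τ ∈ out, ∃ m ∈ M, τ.Denotes I m) ∧ (∀ m ∈ M, ∃ τ ∈ out, τ.Denotes I m)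

/-! ### Algorithms with an oracle for the prices -/

/-- A kind of access to hidden prices: a question of type `Query` about an ordered pair of
prices is answered by an element of `Answer`. -/
structure PriceOracle where
  Query : Type
  Answer : Type
  eval : Query → ℕ → ℕ → Answer

/-- The comparison model: two prices can be compared, the answer being `<`, `=` or `>`. -/
def comparisonModel : PriceOracle where
  Query := Unit
  Answer := Ordering
  eval _ p q := compare p q

/-- The binary query model: any function `f : ℕ × ℕ → {0, 1}` can be evaluated on two prices. -/
def binaryQueryModel : PriceOracle where
  Query := ℕ → ℕ → Bool
  Answer := Bool
  eval f p q := f p q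

/-- What an algorithm does in a given state: stop with an output, make a step of computation of
its own, or query the oracle on the prices of two orders and continue according to the
answer. -/
inductive Action (O : PriceOracle) (State : Type) where
  | halt (out : List TransactionTerm)
  | compute (next : State)
  | query (f : O.Query) (x y : OrderRef) (next : O.Answer → State)

/-- A (deterministic) algorithm: an abstract machine with an arbitrary set of states, whose
initial state depends only on the explicitly given part of the input, and which learns about
the prices only through the oracle. -/
structure Algorithm (O : PriceOracle) where
  State : Type
  init : PublicInput → State
  action : State → Action O State

/-- `A.RunsFrom I s t out`: on the input `I` and from the state `s`, the algorithm stops with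
the output `out` after exactly `t` steps, where each step of computation and each oracle query
takes unit time. (A query about a nonexistent order never returns.) -/
inductive Algorithm.RunsFrom {O : PriceOracle} (A : Algorithm O) (I : Market) :
    A.State → ℕ → List TransactionTerm → Prop
  | halt {s : A.State} {out : List TransactionTerm} (h : A.action s = .halt out) :
      A.RunsFrom I s 0 out
  | compute {s s' : A.State} {t : ℕ} {out : List TransactionTerm}
      (h : A.action s = .compute s') (hrun : A.RunsFrom I s' t out) :
      A.RunsFrom I s (t + 1) out
  | query {s : A.State} {f : O.Query} {x y : OrderRef} {next : O.Answer → A.State} {p q t : ℕ}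
      {out : List TransactionTerm} (h : A.action s = .query f x y next)
      (hx : I.price? x = some p) (hy : I.price? y = some q)
      (hrun : A.RunsFrom I (next (O.eval f p q)) t out) :
      A.RunsFrom I s (t + 1) out

/-- On the input `I` the algorithm stops with output `out` after running for time `t`. -/
def Algorithm.Runs {O : PriceOracle} (A : Algorithm O) (I : Market) (t : ℕ)
    (out : List TransactionTerm) : Prop :=
  A.RunsFrom I (A.init I.publicInput) t out

/-- On every input the algorithm stops and outputs a matching of maximum volume. -/
def Algorithm.ComputesMaxVolumeMatching {O : PriceOracle} (A : Algorithm O) : Prop :=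
  ∀ I : Market, ∃ (t : ℕ) (out : List TransactionTerm) (M : Finset Transaction),
    A.Runs I t out ∧ OutputDenotes I out M ∧ IsMaxVolumeMatching I M

/-- The worst-case running time of `A` on inputs with `n` orders is at least `r`: on some such
input, `A` runs for time at least `r`. -/
def Algorithm.WorstCaseTimeAtLeast {O : PriceOracle} (A : Algorithm O) (n : ℕ) (r : ℝ) : Prop :=
  ∃ I : Market, I.size = n ∧
    ∃ (t : ℕ) (out : List TransactionTerm), A.Runs I t out ∧ r ≤ (t : ℝ)

end Exchange

namespace Exchange

open Finset

/-! The bound is information-theoretic. Fix the public input and let a permutation `σ` of `m`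
elements determine the hidden ask prices. The equal-price pairs form a matching of volume `m`, the
total ask quantity, so a maximum matching sells every ask. Its total ask price is then `1 + ⋯ + m`,
which is also the most the traded bids can total. Hence tradability is an equality wherever the
quantity is positive, and the output reveals `σ` (`perm_eq_of_output_eq`).

All `m!` runs start in one state and branch at most three ways per query, so `m! ≤ 3 ^ T`
(`Algorithm.factorial_le`), and `log m! ≥ m (log m - 1)` gives `Ω(n log n)`. Only the number of
answers per query matters, so binary queries obey this bound too, which is stronger than `n √(log
n)`. -/

/-- In time `T`, an algorithm can produce at most `3 ^ T` outputs if an oracle query has at most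
three answers. -/
theorem Algorithm.exists_outputs_card_le {O : PriceOracle} [Fintype O.Answer]
    (hO : Fintype.card O.Answer ≤ 3) (A : Algorithm O) (T : ℕ) (s : A.State) :
    ∃ S : Finset (List TransactionTerm), S.card ≤ 3 ^ T ∧
      ∀ (I : Market) (t : ℕ) (out : List TransactionTerm),
        t ≤ T → A.RunsFrom I s t out → out ∈ S := by
  classical
  induction T generalizing s with
  | zero =>
    cases hs : A.action s with
    | halt o =>
      refine ⟨{o}, by simp, fun I t out ht hr => ?_⟩
      cases hr <;> simp_all
    | compute s' =>
      refine ⟨∅, by simp, fun I t out ht hr => ?_⟩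
      cases hr <;> simp_all
    | query f x y next =>
      refine ⟨∅, by simp, fun I t out ht hr => ?_⟩
      cases hr <;> simp_all
  | succ T ih =>
    cases hs : A.action s with
    | halt o =>
      refine ⟨{o}, by simpa using Nat.one_le_pow _ _ (by norm_num), fun I t out ht hr => ?_⟩
      cases hr <;> simp_all
    | compute s' =>
      obtain ⟨S, hS, h⟩ := ih s'
      refine ⟨S, hS.trans (Nat.pow_le_pow_right (by norm_num) (by omega)),
        fun I t out ht hr => ?_⟩
      cases hr with
      | halt h' => simp_all
      | compute h' hrun =>
        rw [hs] at h'
        cases h'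
        exact h I _ out (by omega) hrun
      | query h' => simp_all
    | query f x y next =>
      choose S hS h using fun a => ih (next a)
      refine ⟨univ.biUnion S, ?_, fun I t out ht hr => ?_⟩
      · calc (univ.biUnion S).card ≤ Fintype.card O.Answer * 3 ^ T :=
              card_biUnion_le_card_mul _ _ _ fun a _ => hS a
          _ ≤ 3 * 3 ^ T := Nat.mul_le_mul_right _ hO
          _ = 3 ^ (T + 1) := by ring
      · cases hr with
        | halt h' => simp_all
        | compute h' => simp_all
        | query h' hx hy hrun =>
          rw [hs] at h'
          cases h'
          exact mem_biUnion.2 ⟨_, mem_univ _, h _ I _ out (by omega) hrun⟩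

/-! ### Hard instances indexed by permutations -/

section PermutedMarket

/-- The bids of `permutedMarket`: the `i`-th one has price `i + 1` if `i < m`, and price `0`
otherwise. -/
def rankedBid (m i : ℕ) : TradeOrder := ⟨i, i, if i < m then i + 1 else 0, 1, le_rfl⟩

/-- The asks of `permutedMarket`: the `j`-th one has price `σ j + 1`. -/
def permutedAsk {m : ℕ} (k : ℕ) (σ : Equiv.Perm (Fin m)) (j : Fin m) : TradeOrder :=
  ⟨m + k + j, m + k + j, σ j + 1, 1, le_rfl⟩

theorem rankedBid_injective (m : ℕ) : Function.Injective (rankedBid m) :=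
  fun _ _ h => congrArg TradeOrder.id h

theorem permutedAsk_injective {m : ℕ} (k : ℕ) (σ : Equiv.Perm (Fin m)) :
    Function.Injective (permutedAsk k σ) := by
  intro i j h
  have := congrArg TradeOrder.id h
  simp only [permutedAsk] at this
  exact Fin.ext (by omega)

theorem rankedBid_ne_permutedAsk {m k : ℕ} {σ : Equiv.Perm (Fin m)} {i : ℕ} {j : Fin m}
    (hi : i < m + k) : rankedBid m i ≠ permutedAsk k σ j := by
  intro h
  have := congrArg TradeOrder.id h
  simp only [rankedBid, permutedAsk] at this
  omega

/-- Ids and timestamps are both the global position of the order, so one argument serves for both.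
-/
theorem nodup_append_of_ranked {m k : ℕ} {σ : Equiv.Perm (Fin m)} (f : TradeOrder → ℕ)
    (hb : ∀ i, f (rankedBid m i) = i) (ha : ∀ j, f (permutedAsk k σ j) = m + k + j) :
    (((List.range (m + k)).map (rankedBid m) ++ List.ofFn (permutedAsk k σ)).map f).Nodup := by
  rw [List.map_append, List.map_map, List.map_ofFn, List.nodup_append']
  refine ⟨?_, ?_, ?_⟩
  · refine List.Nodup.map (fun i j h => ?_) List.nodup_range
    simpa [hb] using h
  · refine List.nodup_ofFn.2 fun i j h => Fin.ext ?_
    simpa [ha] using h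
  · intro x hx hy
    simp only [List.mem_map, List.mem_range, Function.comp_apply, hb, List.mem_ofFn, ha] at hx hy
    obtain ⟨i, hi, rfl⟩ := hx
    obtain ⟨j, hj⟩ := hy
    omega

/-- The market of `m` bids of prices `1, …, m`, in this order, `k` bids of price `0`, and `m` asks
whose prices are `1, …, m` permuted by `σ`; all quantities are one. -/
def permutedMarket {m : ℕ} (k : ℕ) (σ : Equiv.Perm (Fin m)) : Market where
  bids := (List.range (m + k)).map (rankedBid m)
  asks := List.ofFn (permutedAsk k σ)
  nodup_ids := nodup_append_of_ranked _ (fun _ => rfl) fun _ => rfl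
  nodup_timestamps := nodup_append_of_ranked _ (fun _ => rfl) fun _ => rfl

variable {m k : ℕ} {σ : Equiv.Perm (Fin m)}

theorem size_permutedMarket : (permutedMarket k σ).size = 2 * m + k := by
  simp [Market.size, permutedMarket]
  omega

/-- The permutation enters only through prices, so the initial state cannot depend on it. -/
theorem publicInput_permutedMarket (σ σ' : Equiv.Perm (Fin m)) :
    (permutedMarket k σ).publicInput = (permutedMarket k σ').publicInput := by
  simp only [Market.publicInput, permutedMarket, List.map_ofFn]
  rfl

theorem mem_bids_permutedMarket {w : TradeOrder} :
    w ∈ (permutedMarket k σ).bids ↔ ∃ i < m + k, rankedBid m i = w := by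
  simp [permutedMarket]

theorem mem_asks_permutedMarket {w : TradeOrder} :
    w ∈ (permutedMarket k σ).asks ↔ ∃ j, permutedAsk k σ j = w := by
  simp [permutedMarket, List.mem_ofFn]

/-- The matching of the orders of equal prices. -/
def equalPriceMatching (k : ℕ) (σ : Equiv.Perm (Fin m)) : Finset Transaction :=
  univ.image fun j => ⟨rankedBid m (σ j), permutedAsk k σ j, 1, 0⟩

theorem sum_equalPriceMatching (f : Transaction → ℕ) :
    ∑ x ∈ equalPriceMatching k σ, f x =
      ∑ j, f ⟨rankedBid m (σ j), permutedAsk k σ j, 1, 0⟩ := by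
  refine sum_image fun i _ j _ h => ?_
  exact permutedAsk_injective k σ (congrArg Transaction.ask h)

theorem volume_equalPriceMatching : volume (equalPriceMatching k σ) = m := by
  simp [volume, sum_equalPriceMatching]

theorem isMatching_equalPriceMatching :
    IsMatching (permutedMarket k σ) (equalPriceMatching k σ) where
  bid_mem x hx := by
    simp only [equalPriceMatching, mem_image, mem_univ, true_and] at hx
    obtain ⟨j, rfl⟩ := hx
    exact mem_bids_permutedMarket.2 ⟨σ j, by omega, rfl⟩
  ask_mem x hx := by
    simp only [equalPriceMatching, mem_image, mem_univ, true_and] at hx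
    obtain ⟨j, rfl⟩ := hx
    exact mem_asks_permutedMarket.2 ⟨j, rfl⟩
  tradable x hx := by
    simp only [equalPriceMatching, mem_image, mem_univ, true_and] at hx
    obtain ⟨j, rfl⟩ := hx
    simp [Tradable, rankedBid, permutedAsk]
  qty_le w hw := by
    rw [tradedQty, sum_filter, sum_equalPriceMatching]
    rcases List.mem_append.1 hw with hw | hw
    · obtain ⟨i, hi, rfl⟩ := mem_bids_permutedMarket.1 hw
      rw [← sum_filter, sum_const, smul_eq_mul, mul_one]
      refine card_le_one.2 fun a ha b hb => ?_
      simp only [mem_filter, mem_univ, true_and, (rankedBid_ne_permutedAsk hi).symm, or_false,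
        (rankedBid_injective m).eq_iff] at ha hb
      exact σ.injective (Fin.ext (ha.trans hb.symm))
    · obtain ⟨j, rfl⟩ := mem_asks_permutedMarket.1 hw
      rw [← sum_filter, sum_const, smul_eq_mul, mul_one]
      refine card_le_one.2 fun a ha b hb => ?_
      have hne (a : Fin m) : rankedBid m (σ a) ≠ permutedAsk k σ j :=
        rankedBid_ne_permutedAsk (by omega)
      simp only [mem_filter, mem_univ, true_and, hne, false_or,
        (permutedAsk_injective k σ).eq_iff] at ha hb
      exact ha.trans hb.symm

/-! ### Rigidity of maximum volume matchings -/

theorem sum_mul_eq_sum_fiber {ι α β : Type*} [DecidableEq β] (M : Finset α) (s : Finset ι)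
    (e : ι → β) (he : Function.Injective e) (p : α → β) (hp : ∀ x ∈ M, ∃ i ∈ s, e i = p x)
    (q : α → ℕ) (g : β → ℕ) :
    ∑ x ∈ M, q x * g (p x) = ∑ i ∈ s, (∑ x ∈ M with p x = e i, q x) * g (e i) := by
  rw [← sum_fiberwise_of_maps_to (t := s.image e) (g := p)
    (fun x hx => mem_image.2 (hp x hx)), sum_image fun i _ j _ h => he h]
  refine sum_congr rfl fun i _ => ?_
  rw [sum_mul]
  exact sum_congr rfl fun x hx => by rw [(mem_filter.1 hx).2]

theorem sum_bid_le_tradedQty (w : TradeOrder) (M : Finset Transaction) :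
    ∑ x ∈ M with x.bid = w, x.qty ≤ tradedQty w M :=
  sum_le_sum_of_subset (monotone_filter_right _ fun _ _ h => Or.inl h)

theorem sum_ask_le_tradedQty (w : TradeOrder) (M : Finset Transaction) :
    ∑ x ∈ M with x.ask = w, x.qty ≤ tradedQty w M :=
  sum_le_sum_of_subset (monotone_filter_right _ fun _ _ h => Or.inr h)

/-- The volume is at least `m`, while each of the `m` asks contributes at most one to it; no ask can
fall short. -/
theorem IsMaxVolumeMatching.sum_ask_eq_one {M : Finset Transaction}
    (hM : IsMaxVolumeMatching (permutedMarket k σ) M) (j : Fin m) :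
    ∑ x ∈ M with x.ask = permutedAsk k σ j, x.qty = 1 := by
  have hle (j : Fin m) : ∑ x ∈ M with x.ask = permutedAsk k σ j, x.qty ≤ 1 :=
    (sum_ask_le_tradedQty _ M).trans
      (hM.1.qty_le _ (List.mem_append_right _ (mem_asks_permutedMarket.2 ⟨j, rfl⟩)))
  have hvol := hM.2 _ isMatching_equalPriceMatching
  have hsum := sum_mul_eq_sum_fiber M univ (permutedAsk k σ) (permutedAsk_injective k σ)
    Transaction.ask
    (fun x hx => by simpa using mem_asks_permutedMarket.1 (hM.1.ask_mem x hx))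
    Transaction.qty fun _ => 1
  simp only [mul_one] at hsum
  rw [volume_equalPriceMatching, volume, hsum] at hvol
  have h1 : ∑ _j : Fin m, 1 = m := by simp
  exact (sum_eq_sum_iff_of_le fun j _ => hle j).1
    (le_antisymm (sum_le_sum fun j _ => hle j) (h1.trans_le hvol)) j (mem_univ j)

/-- In a matching of maximum volume over `permutedMarket k σ`, only orders of equal prices trade:
the total price of the bids that trade cannot exceed that of the asks. -/
theorem IsMaxVolumeMatching.bid_price_eq_ask_price {M : Finset Transaction}
    (hM : IsMaxVolumeMatching (permutedMarket k σ) M) {x : Transaction} (hx : x ∈ M)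
    (hq : 0 < x.qty) : x.bid.price = x.ask.price := by
  have hask := sum_mul_eq_sum_fiber M univ (permutedAsk k σ) (permutedAsk_injective k σ)
    Transaction.ask
    (fun x hx => by simpa using mem_asks_permutedMarket.1 (hM.1.ask_mem x hx))
    Transaction.qty TradeOrder.price
  have hbid := sum_mul_eq_sum_fiber M (range (m + k)) (rankedBid m) (rankedBid_injective m)
    Transaction.bid
    (fun x hx => by simpa using mem_bids_permutedMarket.1 (hM.1.bid_mem x hx))
    Transaction.qty TradeOrder.price
  have hask' : ∑ x ∈ M, x.qty * x.ask.price = ∑ i ∈ range m, (i + 1) := by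
    rw [hask]
    simp only [hM.sum_ask_eq_one, one_mul]
    rw [sum_range]
    exact Equiv.sum_comp σ fun i : Fin m => (i : ℕ) + 1
  -- An upper bound suffices here: each bid trades at most one unit, and the `k` padding bids have
  -- price zero.
  have hbid' : ∑ x ∈ M, x.qty * x.bid.price ≤ ∑ i ∈ range m, (i + 1) := by
    rw [hbid]
    calc _ ≤ ∑ i ∈ range (m + k), (rankedBid m i).price := by
          refine sum_le_sum fun i hi => ?_
          have hle := (sum_bid_le_tradedQty (rankedBid m i) M).trans
            (hM.1.qty_le _ (List.mem_append_left _
              (mem_bids_permutedMarket.2 ⟨i, mem_range.1 hi, rfl⟩)))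
          exact (Nat.mul_le_mul_right _ hle).trans_eq (one_mul _)
      _ = ∑ i ∈ range m, (i + 1) := by
          rw [sum_range_add]
          simp only [rankedBid]
          rw [sum_congr rfl fun i hi => if_pos (mem_range.1 hi)]
          simp
  have hle : ∀ x ∈ M, x.qty * x.ask.price ≤ x.qty * x.bid.price :=
    fun x hx => Nat.mul_le_mul_left _ (hM.1.tradable x hx)
  have := (sum_eq_sum_iff_of_le hle).1
    (le_antisymm (sum_le_sum hle) (hbid'.trans_eq hask'.symm)) x hx
  exact (Nat.eq_of_mul_eq_mul_left hq this).symm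

theorem IsMaxVolumeMatching.term_bid_eq {M : Finset Transaction}
    (hM : IsMaxVolumeMatching (permutedMarket k σ) M) {x : Transaction} (hx : x ∈ M)
    (hq : 0 < x.qty) {τ : TransactionTerm} (hτ : τ.Denotes (permutedMarket k σ) x) {j : Fin m}
    (hj : τ.ask = j) : τ.bid = σ j := by
  obtain ⟨hb, ha, -, -⟩ := hτ
  have hp := hM.bid_price_eq_ask_price hx hq
  rw [hj] at ha
  simp only [permutedMarket, List.getElem?_ofFn, Fin.is_lt, dite_true, Fin.eta,
    Option.some.injEq] at ha
  simp only [permutedMarket, List.getElem?_map, Option.map_eq_some_iff] at hb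
  obtain ⟨i, hi, hb⟩ := hb
  obtain ⟨_, rfl⟩ := List.getElem?_eq_some_iff.1 hi
  rw [← ha, ← hb] at hp
  simp only [List.getElem_range, rankedBid, permutedAsk] at hp
  -- Ask prices are at least one, which excludes the padding bids of price zero.
  split_ifs at hp
  omega

theorem IsMaxVolumeMatching.exists_term {M : Finset Transaction} {out : List TransactionTerm}
    (hM : IsMaxVolumeMatching (permutedMarket k σ) M)
    (hout : OutputDenotes (permutedMarket k σ) out M) (j : Fin m) :
    ∃ τ ∈ out, τ.ask = j ∧ 0 < τ.qty := by
  obtain ⟨x, hx, hq⟩ := exists_ne_zero_of_sum_ne_zero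
    ((hM.sum_ask_eq_one j).trans_ne one_ne_zero)
  obtain ⟨hx, hxj⟩ := mem_filter.1 hx
  obtain ⟨τ, hτ, -, ha, hτq, -⟩ := hout.2 x hx
  refine ⟨τ, hτ, ?_, by omega⟩
  rw [hxj] at ha
  simp only [permutedMarket, List.getElem?_ofFn] at ha
  split_ifs at ha with h
  exact congrArg Fin.val (permutedAsk_injective k σ (Option.some.inj ha))

theorem perm_eq_of_output_eq {σ' : Equiv.Perm (Fin m)} {M M' : Finset Transaction}
    {out : List TransactionTerm} (hM : IsMaxVolumeMatching (permutedMarket k σ) M)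
    (hout : OutputDenotes (permutedMarket k σ) out M)
    (hM' : IsMaxVolumeMatching (permutedMarket k σ') M')
    (hout' : OutputDenotes (permutedMarket k σ') out M') : σ = σ' := by
  ext j
  obtain ⟨τ, hτ, hj, hq⟩ := hM.exists_term hout j
  obtain ⟨x, hx, hd⟩ := hout.1 τ hτ
  obtain ⟨x', hx', hd'⟩ := hout'.1 τ hτ
  -- The same written term, of positive quantity, is read in both markets; its bid index is both `σ
  -- j` and `σ' j`.
  rw [← hM.term_bid_eq hx (hd.2.2.1 ▸ hq) hd hj, ← hM'.term_bid_eq hx' (hd'.2.2.1 ▸ hq) hd' hj]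

end PermutedMarket

/-! ### Counting outputs and the numerical estimates -/

/-- If an algorithm takes time at most `T` on the markets `permutedMarket k σ`, then its outputs
on them, which are pairwise distinct, number at most `3 ^ T`. -/
theorem Algorithm.factorial_le {O : PriceOracle} [Fintype O.Answer]
    (hO : Fintype.card O.Answer ≤ 3) (A : Algorithm O) (hA : A.ComputesMaxVolumeMatching)
    (m k T : ℕ)
    (hT : ∀ (σ : Equiv.Perm (Fin m)) (t : ℕ) (out : List TransactionTerm),
      A.Runs (permutedMarket k σ) t out → t ≤ T) :
    m.factorial ≤ 3 ^ T := by
  classical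
  obtain ⟨S, hS, h⟩ := A.exists_outputs_card_le hO T
    (A.init (permutedMarket k (1 : Equiv.Perm (Fin m))).publicInput)
  choose t out M hrun hout hM using fun σ : Equiv.Perm (Fin m) => hA (permutedMarket k σ)
  have hinj : Function.Injective out := fun σ σ' e =>
    perm_eq_of_output_eq (hM σ) (hout σ) (hM σ') (e ▸ hout σ')
  calc m.factorial = (univ : Finset (Equiv.Perm (Fin m))).card := by
        rw [card_univ, Fintype.card_perm, Fintype.card_fin]
    _ = (univ.image out).card := (card_image_of_injective _ hinj).symm
    _ ≤ S.card := card_le_card fun o ho => by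
        obtain ⟨σ, -, rfl⟩ := mem_image.1 ho
        refine h (permutedMarket k σ) _ _ (hT σ _ _ (hrun σ)) ?_
        rw [publicInput_permutedMarket 1 σ]
        exact hrun σ
    _ ≤ 3 ^ T := hS

/-- Take logarithms in `m ^ m / m! ≤ e ^ m`, one term of the exponential series. -/
theorem mul_log_sub_le_log_factorial {m : ℕ} (hm : 0 < m) :
    (m : ℝ) * (Real.log m - 1) ≤ Real.log m.factorial := by
  have hm' : (0 : ℝ) < m := by exact_mod_cast hm
  have hf : (0 : ℝ) < m.factorial := by exact_mod_cast m.factorial_pos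
  have h := Real.log_le_log (by positivity) (Real.pow_div_factorial_le_exp (m : ℝ) hm'.le m)
  rw [Real.log_exp, Real.log_div (by positivity) hf.ne', Real.log_pow] at h
  linarith

theorem log_three_le_two : Real.log 3 ≤ 2 := by
  have := Real.log_le_sub_one_of_pos (show (0 : ℝ) < 3 by norm_num)
  linarith

theorem six_le_log {n : ℕ} (hn : 1024 ≤ n) : 6 ≤ Real.log n := by
  have h : Real.log ((2 : ℝ) ^ 10) ≤ Real.log n :=
    Real.log_le_log (by norm_num) (by norm_num; exact_mod_cast hn)
  rw [Real.log_pow] at h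
  have := Real.log_two_gt_d9
  norm_num at h
  linarith

/-- The lower bound `Ω(n log n)` for every oracle whose queries have at most three answers. -/
theorem Algorithm.worstCaseTimeAtLeast_mul_log {O : PriceOracle} [Fintype O.Answer]
    (hO : Fintype.card O.Answer ≤ 3) (A : Algorithm O) (hA : A.ComputesMaxVolumeMatching)
    {n : ℕ} (hn : 1024 ≤ n) :
    A.WorstCaseTimeAtLeast n (1 / 24 * ((n : ℝ) * Real.log n)) := by
  by_contra hcon
  set r : ℝ := 1 / 24 * ((n : ℝ) * Real.log n) with hr
  have hlog := six_le_log hn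
  have hn0 : (0 : ℝ) < n := by exact_mod_cast (by omega : 0 < n)
  have hr0 : 0 < r := by positivity
  have hfac : (n / 2).factorial ≤ 3 ^ ⌊r⌋₊ := by
    -- One padding bid makes the number of orders exactly `n` when `n` is odd.
    refine A.factorial_le hO hA (n / 2) (n % 2) _ fun σ t out hrun => ?_
    by_contra! ht
    exact hcon ⟨_, size_permutedMarket.trans (by omega), t, out, hrun,
      (Nat.lt_of_floor_lt ht).le⟩
  have hm : (n : ℝ) / 3 ≤ (n / 2 : ℕ) := by
    rw [div_le_iff₀ (by norm_num)]
    exact_mod_cast (by omega : n ≤ n / 2 * 3)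
  have hlogm : Real.log n - 3 ≤ Real.log (n / 2 : ℕ) - 1 := by
    have h := Real.log_le_log (by positivity) hm
    rw [Real.log_div hn0.ne' (by norm_num)] at h
    linarith [log_three_le_two]
  have hlow := mul_log_sub_le_log_factorial (m := n / 2) (by omega)
  have hup : Real.log (n / 2).factorial ≤ 2 * r := by
    have h := Real.log_le_log (by exact_mod_cast (n / 2).factorial_pos)
      (show ((n / 2).factorial : ℝ) ≤ 3 ^ ⌊r⌋₊ by exact_mod_cast hfac)
    rw [Real.log_pow] at h
    calc _ ≤ _ := h
      _ ≤ r * 2 := mul_le_mul (Nat.floor_le hr0.le) log_three_le_two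
          (Real.log_nonneg (by norm_num)) hr0.le
      _ = 2 * r := mul_comm _ _
  -- Since `log n ≥ 6`, we have `log n - 3 ≥ log n / 2`. With the constant `1 / 24` the left side is
  -- `4 * r`, against the upper bound `2 * r` for `log (n / 2)!`.
  have hmid : (n : ℝ) / 3 * (Real.log n / 2) ≤
      (n / 2 : ℕ) * (Real.log (n / 2 : ℕ) - 1) :=
    mul_le_mul hm (by linarith) (by positivity) (by positivity)
  have : (n : ℝ) / 3 * (Real.log n / 2) = 4 * r := by rw [hr]; ring
  linarith

instance : Fintype comparisonModel.Answer := inferInstanceAs (Fintype Ordering)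

instance : Fintype binaryQueryModel.Answer := inferInstanceAs (Fintype Bool)

theorem Algorithm.WorstCaseTimeAtLeast.mono {O : PriceOracle} {A : Algorithm O} {n : ℕ}
    {r r' : ℝ} (h : A.WorstCaseTimeAtLeast n r) (hr : r' ≤ r) : A.WorstCaseTimeAtLeast n r' := by
  obtain ⟨I, hI, t, out, hrun, ht⟩ := h
  exact ⟨I, hI, t, out, hrun, hr.trans ht⟩

end Exchange

theorem theorem3 :
    (∃ c : ℝ, 0 < c ∧ ∃ n₀ : ℕ,
      ∀ A : Exchange.Algorithm Exchange.comparisonModel, A.ComputesMaxVolumeMatching →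
        ∀ n : ℕ, n₀ ≤ n → A.WorstCaseTimeAtLeast n (c * ((n : ℝ) * Real.log n))) ∧
    (∃ c : ℝ, 0 < c ∧ ∃ n₀ : ℕ,
      ∀ A : Exchange.Algorithm Exchange.binaryQueryModel, A.ComputesMaxVolumeMatching →
        ∀ n : ℕ, n₀ ≤ n → A.WorstCaseTimeAtLeast n (c * ((n : ℝ) * √(Real.log n)))) := by
  refine ⟨⟨1 / 24, by norm_num, 1024, fun A hA n hn => ?_⟩,
    ⟨1 / 24, by norm_num, 1024, fun A hA n hn => ?_⟩⟩
  · exact A.worstCaseTimeAtLeast_mul_log (by decide) hA hn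
  -- Weaken the `n log n` bound, using `√x ≤ x` for `x ≥ 1`.
  · refine (A.worstCaseTimeAtLeast_mul_log (by decide) hA hn).mono ?_
    have hlog := Exchange.six_le_log hn
    have : √(Real.log n) ≤ Real.log n := Real.sqrt_le_iff.2 ⟨by linarith, by nlinarith⟩
    gcongr
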